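/- Let $k$ be a field of characteristic $0$, $G$ a finite group and $H$ a finite abelian group. Cocycles are normalized 2-cocycles for the trivial action ($\alpha(e,g)=\alpha(g,e)=1$). Put $\epsilon_\alpha(g,h)=\alpha(g,h)/\alpha(ghg^{-1},g)$. A $G$-Frobenius algebra over $k$ is a finite-dimensional $G$-graded unital associative algebra $A=\bigoplus_g A_g$ with a nondegenerate bilinear form $\eta$ pairing $A_g$ only with $A_{g^{-1}}$ and satisfying $\eta(a,bc)=\eta(ab,c)$, an action $\varphi$ of $G$ by algebra automorphisms with $\varphi_g(A_h)\subset A_{ghg^{-1}}$, and a character $\xi\colon G\to k^*$, such that for $a_g\in A_g$, $b_h\in A_h$: $a_gb_h=\varphi_g(b_h)a_g$; $\varphi_g|_{A_g}=\xi_g^{-1}\mathrm{id}$; $\varphi_g^*\eta=\xi_g^{-2}\eta$; and for $c\in A_{ghg^{-1}h^{-1}}$ with left multiplication $l_c$: $\xi_h\mathrm{Tr}(l_c\varphi_h|_{A_g})=\xi_{g^{-1}}\mathrm{Tr}(\varphi_{g^{-1}}l_c|_{A_h})$. Isomorphisms preserve all this structure, including degrees. Twist. For $\alpha\in Z^2(G,k^*)$,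 the $G$-Frobenius algebra $k^\alpha[G]$ has basis $\hat g$ in degree $g$, $\hat g\hat h=\alpha(g,h)\widehat{gh}$, unit $\hat e$, $\varphi_g(\hat h)=\epsilon_\alpha(g,h)\widehat{ghg^{-1}}$, $\eta(\hat g,\widehat{g^{-1}})=\alpha(g,g^{-1})$ and trivial character. The twist of $A$ is $A_\alpha=\bigoplus_g A_g\otimes k\hat g$ with the tensor product structures. Extension. For $\alpha'\in Z^2(G,H)$ let $G^{\alpha'}=H\times G$ with $(a,g)(b,h)=(ab\,\alpha'(g,h),gh)$, $\pi(a,g)=g$, $s(g)=(e,g)$. Let $A^{\alpha'}=A\#_{\alpha'}k[H]$ have component $A_g\otimes kh$ in degree $(h,g)$, multiplication $(a_g\otimes h)(c_{g'}\otimes h')=a_gc_{g'}\otimes\alpha'(g,g')hh'$, unit $1\otimes e$, action $\varphi_{(h,g)}(c_{g'}\otimes h')=\varphi_g(c_{g'})\otimes\epsilon_{\alpha'}(g,g')h'$, form $\eta(a_g\otimes h,c_{g'}\otimes h')=\eta(a_g,c_{g'})$ if $(h,g)(h',g')=e$ and $0$ otherwise, and character $(h,g)\mapsto\xi_g$. Push-down.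 For $\chi\in\mathrm{Hom}(H,k^*)$, $(A^{\alpha'})^\chi$ is the structure induced on $\bigoplus_g A_g\otimes ke$ by the linear map $p(a\otimes h)=\chi(h)\,a\otimes e$: the product of $x,y$ is $p(xy)$, $g$ acts on $x$ by $p(\varphi_{s(g)}x)$, the unit is $1\otimes e$, the character is $g\mapsto\xi_g$, and the form is the one for which $p$ preserves the pairing of components of mutually inverse degrees. Lifting. A $G$-Frobenius algebra $F$ lifts along $\chi$ to a $G^{\alpha'}$-Frobenius algebra $E$ if there are linear maps $i\colon F\to E$, $\mathrm{res}\colon E\to F$ such that, with $\rho$ the coactions $a_g\mapsto a_g\otimes g$ and $\chi\colon k[G^{\alpha'}]\to k[G]$, $(h,g)\mapsto\chi(h)g$: $(\mathrm{res}\otimes\chi)\circ\rho_E\circ i=\rho_F$; $\mathrm{res}(i(a)i(b))=ab$; $\mathrm{res}(\varphi_{s(g)}i(a))=\varphi_g(a)$; and all structures are compatible: $i(F_g)\subset E_{s(g)}$, $\mathrm{res}(E_\gamma)\subset F_{\pi(\gamma)}$, $i$ and $\mathrm{res}$ preserve the units, $\mathrm{res}$ is multiplicative, $\mathrm{res}\circ\varphi_\gamma=\varphi_{\pi(\gamma)}\circ\mathrm{res}$,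 $\mathrm{res}$ preserves the pairing of components of mutually inverse degrees, and the character of $E$ is that of $F$ composed with $\pi$. For $\beta\in Z^2(G,H)$, $G^\beta$ is called a universal extension (representation group) of $G$ over $k$ if $H\cong H^2(G,k^*)$ and every finite-dimensional projective representation $\rho$ of $G$ over $k$ lifts to $G^\beta$, i.e. there is a linear representation of $G^\beta$ on the same space that agrees with $\rho\circ\pi$ up to scalars. Theorem. Let $A$ be a $G$-Frobenius algebra. (1) Let $\alpha\in Z^2(G,k^*)$, $\alpha'\in Z^2(G,H)$ and $\chi\in\mathrm{Hom}(H,k^*)$ satisfy $\alpha(g,g')=\chi(\alpha'(g,g'))$ for all $g,g'$. Then $A_\alpha$ and $(A^{\alpha'})^\chi$ are $G$-Frobenius algebras, $A^{\alpha'}$ is a $G^{\alpha'}$-Frobenius algebra, $A_\alpha$ lifts along $\chi$ to $A^{\alpha'}$, and $(A^{\alpha'})^\chi\cong A_\alpha$. (2) If $\beta\in Z^2(G,H)$ and $G^\beta$ is a universal extension of $G$ over $k$, then for every $\alpha\in Z^2(G,k^*)$ there is a $\chi\in\mathrm{Hom}(H,k^*)$ along which the $G$-Frobenius algebra $A_\alpha$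 lifts to the $G^\beta$-Frobenius algebra $A^\beta$. -/

import Mathlib

open scoped TensorProduct DirectSum

noncomputable section

universe u v w x y

namespace GFrob

/-! ### Cocycles with values in an abelian group with trivial action, and central extensions -/

/-- The group `Z²(G, M)` of normalized `2`-cocycles of `G` with values in the abelian group `M`,
for the trivial action of `G` on `M`. -/
def Z2 (G : Type v) (M : Type w) [Group G] [CommGroup M] : Subgroup (G → G → M) where
  carrier := {α | (∀ g h l, α g h * α (g * h) l = α h l * α g (h * l)) ∧
    (∀ g, α 1 g = 1) ∧ ∀ g, α g 1 = 1}
  one_mem' := by simp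
  mul_mem' := by
    rintro a b ⟨ha, ha1, ha2⟩ ⟨hb, hb1, hb2⟩
    refine ⟨fun g h l => ?_, fun g => by simp [ha1, hb1], fun g => by simp [ha2, hb2]⟩
    simp only [Pi.mul_apply]
    rw [mul_mul_mul_comm, ha, hb, mul_mul_mul_comm]
  inv_mem' := by
    rintro a ⟨ha, ha1, ha2⟩
    refine ⟨fun g h l => ?_, fun g => by simp [ha1], fun g => by simp [ha2]⟩
    simp only [Pi.inv_apply]
    rw [← mul_inv, ha, mul_inv]

/-- The subgroup `B²(G, M)` of `Z²(G, M)` of coboundaries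
`(g, h) ↦ ν(g) ν(h) ν(gh)⁻¹`. -/
def B2 (G : Type v) (M : Type w) [Group G] [CommGroup M] : Subgroup (Z2 G M) where
  carrier := {α | ∃ ν : G → M, ∀ g h, α.1 g h = ν g * ν h * (ν (g * h))⁻¹}
  one_mem' := ⟨fun _ => 1, by simp⟩
  mul_mem' := by
    rintro a b ⟨ν, hν⟩ ⟨ξ, hξ⟩
    refine ⟨fun g => ν g * ξ g, fun g h => ?_⟩
    simp only [Subgroup.coe_mul, Pi.mul_apply, hν, hξ, mul_inv]
    rw [mul_mul_mul_comm, mul_mul_mul_comm (ν g)]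
  inv_mem' := by
    rintro a ⟨ν, hν⟩
    refine ⟨fun g => (ν g)⁻¹, fun g h => ?_⟩
    simp only [Subgroup.coe_inv, Pi.inv_apply, hν, mul_inv]

/-- The second cohomology group `H²(G, M)` for the trivial action of `G` on `M`. -/
abbrev H2 (G : Type v) (M : Type w) [Group G] [CommGroup M] := Z2 G M ⧸ B2 G M

section Extension

variable {G : Type v} {H : Type w} [Group G] [CommGroup H]

/-- The function `ε(g, h) = α(g, h) / α(ghg⁻¹, g)` attached to a `2`-cocycle `α`. -/
def eps (α : Z2 G H) (g h : G) : H := α.1 g h * (α.1 (g * h * g⁻¹) g)⁻¹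

/-- The underlying set `H × G` of the central extension `G^α` of `G` by `H`. -/
@[ext] structure Ext (α : Z2 G H) where
  ker : H
  quo : G

variable {α : Z2 G H}

instance : One (Ext α) := ⟨⟨1, 1⟩⟩

/-- `(a, g) (a', g') = (a a' α(g, g'), g g')`. -/
instance : Mul (Ext α) := ⟨fun γ δ => ⟨γ.ker * δ.ker * α.1 γ.quo δ.quo, γ.quo * δ.quo⟩⟩

instance : Inv (Ext α) := ⟨fun γ => ⟨γ.ker⁻¹ * (α.1 γ.quo⁻¹ γ.quo)⁻¹, γ.quo⁻¹⟩⟩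

@[simp] theorem one_ker : (1 : Ext α).ker = 1 := rfl

@[simp] theorem one_quo : (1 : Ext α).quo = 1 := rfl

@[simp] theorem mul_ker (γ δ : Ext α) :
    (γ * δ).ker = γ.ker * δ.ker * α.1 γ.quo δ.quo := rfl

@[simp] theorem mul_quo (γ δ : Ext α) : (γ * δ).quo = γ.quo * δ.quo := rfl

@[simp] theorem inv_ker (γ : Ext α) :
    (γ⁻¹).ker = γ.ker⁻¹ * (α.1 γ.quo⁻¹ γ.quo)⁻¹ := rfl

@[simp] theorem inv_quo (γ : Ext α) : (γ⁻¹).quo = γ.quo⁻¹ := rfl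

/-- The central extension `1 → H → G^α → G → 1` as a group. -/
instance : Group (Ext α) where
  mul_assoc a b c := by
    ext
    · simp only [mul_ker, mul_quo]
      have h := α.2.1 a.quo b.quo c.quo
      calc _ = a.ker * b.ker * c.ker * (α.1 a.quo b.quo * α.1 (a.quo * b.quo) c.quo) := by
            rw [mul_right_comm (a.ker * b.ker), mul_assoc]
        _ = a.ker * b.ker * c.ker * (α.1 b.quo c.quo * α.1 a.quo (b.quo * c.quo)) := by rw [h]
        _ = _ := by simp only [mul_assoc]
    · simp [mul_assoc]
  one_mul a := by ext <;> simp [α.2.2.1]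
  mul_one a := by ext <;> simp [α.2.2.2]
  inv_mul_cancel a := by
    ext
    · simp only [mul_ker, inv_ker, inv_quo, one_ker]
      rw [mul_right_comm a.ker⁻¹, inv_mul_cancel, one_mul, inv_mul_cancel]
    · simp

/-- The section `s : G → G^α`, `s(g) = (1, g)`; its cocycle is `α`. -/
def sec (α : Z2 G H) (g : G) : Ext α := ⟨1, g⟩

theorem conj_ker {γ δ ω : Ext α} (h : γ * δ * γ⁻¹ = ω) :
    eps α γ.quo δ.quo * δ.ker = ω.ker := by
  have h1 : γ * δ = ω * γ := by rw [← h]; group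
  have h2 : ω.quo = γ.quo * δ.quo * γ.quo⁻¹ := by rw [← h]; rfl
  have h3 := congrArg Ext.ker h1
  simp only [mul_ker] at h3
  rw [h2] at h3
  unfold eps
  rw [mul_right_comm, mul_inv_eq_iff_eq_mul]
  apply mul_left_cancel (a := γ.ker)
  calc γ.ker * (α.1 γ.quo δ.quo * δ.ker) = γ.ker * δ.ker * α.1 γ.quo δ.quo := by
        rw [mul_comm (α.1 γ.quo δ.quo), mul_assoc]
    _ = _ := h3
    _ = _ := by rw [mul_comm ω.ker, mul_assoc]

theorem sec_mul {g h l : G} (e : g * h = l) :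
    sec α g * sec α h = ⟨α.1 g h, l⟩ := by
  ext <;> simp [sec, e]

theorem sec_mul_eq_one {g h : G} (e : g * h = 1) :
    sec α g * ⟨(α.1 g h)⁻¹, h⟩ = 1 := by
  ext <;> simp [sec, e]

theorem sec_conj {g h h' : G} (e : g * h * g⁻¹ = h') :
    sec α g * sec α h * (sec α g)⁻¹ = ⟨eps α g h, h'⟩ := by
  ext
  · have := conj_ker (α := α) (γ := sec α g) (δ := sec α h) rfl
    rw [← this]; simp [sec]
  · simpa [sec] using e

end Extension

/-! ### `G`-Frobenius algebras -/

/-- The structural data of a `G`-Frobenius algebra `A = ⨁ g, V g` over `k`.  The structure maps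
are given on the homogeneous components, so that they respect the grading by construction: the
multiplication `V g × V h → V (g h)`, the unit in `V 1`, the bilinear form, which is zero except
on `V g × V g⁻¹`, the maps `φ_g : V h → V (g h g⁻¹)`, and the values of the character.  A target
degree is passed as a separate argument with a proof of what it is. -/
structure Data (k : Type u) [Field k] (G : Type v) [Group G] (V : G → Type w)
    [∀ g, AddCommGroup (V g)] [∀ g, Module k (V g)] where
  mul : ∀ g h l : G, g * h = l → (V g →ₗ[k] V h →ₗ[k] V l)
  one : V 1
  form : ∀ g h : G, g * h = 1 → (V g →ₗ[k] V h →ₗ[k] k)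
  act : ∀ g h h' : G, g * h * g⁻¹ = h' → (V h →ₗ[k] V h')
  char : G → kˣ

section Algebra

variable {k : Type u} [Field k] {G : Type v} [Group G] {V : G → Type w}
  [∀ g, AddCommGroup (V g)] [∀ g, Module k (V g)]

/-- The axioms of a `G`-Frobenius algebra. -/
structure Data.IsGFrobenius (A : Data k G V) : Prop where
  finite_group : Finite G
  finite_dim : ∀ g, Module.Finite k (V g)
  nondegenerate : ∀ g h e, (A.form g h e).Nondegenerate
  /-- `φ` is an action of the group, -/
  act_one : ∀ h e (a : V h), A.act 1 h h e a = a
  act_mul : ∀ g g' h h' h'' e e' e'' (a : V h),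
    A.act (g * g') h h'' e a = A.act g h' h'' e' (A.act g' h h' e'' a)
  /-- and `char` is a character. -/
  char_mul : ∀ g h, A.char (g * h) = A.char g * A.char h
  /-- Associativity. -/
  mul_assoc : ∀ g h l gh hl ghl e₁ e₂ e₃ e₄ (a : V g) (b : V h) (c : V l),
    A.mul gh l ghl e₂ (A.mul g h gh e₁ a b) c = A.mul g hl ghl e₄ a (A.mul h l hl e₃ b c)
  /-- Twisted commutativity. -/
  twisted_comm : ∀ g h l h' e₁ e₂ e₃ (a : V g) (b : V h),
    A.mul g h l e₁ a b = A.mul h' g l e₂ (A.act g h h' e₃ b) a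
  /-- `G`-invariant unit. -/
  one_mul : ∀ g e (a : V g), A.mul 1 g g e A.one a = a
  mul_one : ∀ g e (a : V g), A.mul g 1 g e a A.one = a
  act_unit : ∀ g e, A.act g 1 1 e A.one = A.one
  /-- Invariance of the metric. -/
  form_mul : ∀ g h l gh hl e₁ e₂ e₃ e₄ (a : V g) (b : V h) (c : V l),
    A.form g hl e₁ a (A.mul h l hl e₂ b c) = A.form gh l e₃ (A.mul g h gh e₄ a b) c
  /-- Projective self-invariance of the twisted sectors. -/
  self_invariance : ∀ g e (a : V g), A.act g g g e a = (((A.char g)⁻¹ : kˣ) : k) • a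
  /-- `G`-invariance of the multiplication. -/
  act_map_mul : ∀ g h l hl h' l' hl' e₁ e₂ e₃ e₄ e₅ (a : V h) (b : V l),
    A.act g hl hl' e₁ (A.mul h l hl e₂ a b) =
      A.mul h' l' hl' e₃ (A.act g h h' e₄ a) (A.act g l l' e₅ b)
  /-- Projective `G`-invariance of the metric. -/
  form_act : ∀ g h l h' l' e₁ e₂ e₃ e₄ (a : V h) (b : V l),
    A.form h' l' e₁ (A.act g h h' e₂ a) (A.act g l l' e₃ b) =
      (((A.char g)⁻¹ ^ 2 : kˣ) : k) * A.form h l e₄ a b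
  /-- Projective trace axiom. -/
  trace : ∀ g h c h' g' (e₁ : h * g * h⁻¹ = h') (e₂ : c * h' = g) (e₃ : c * h = g')
      (e₄ : g⁻¹ * g' * g⁻¹⁻¹ = h) (a : V c),
    (A.char h : k) * LinearMap.trace k (V g) (A.mul c h' g e₂ a ∘ₗ A.act h g h' e₁) =
      (A.char g⁻¹ : k) * LinearMap.trace k (V h) (A.act g⁻¹ g' h e₄ ∘ₗ A.mul c h g' e₃ a)

/-- An isomorphism of `G`-Frobenius algebras. -/
structure Data.Iso {W : G → Type x} [∀ g, AddCommGroup (W g)] [∀ g, Module k (W g)]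
    (A : Data k G V) (B : Data k G W) where
  toEquiv : ∀ g, V g ≃ₗ[k] W g
  map_mul : ∀ g h l e (a : V g) (b : V h),
    toEquiv l (A.mul g h l e a b) = B.mul g h l e (toEquiv g a) (toEquiv h b)
  map_one : toEquiv 1 A.one = B.one
  map_form : ∀ g h e (a : V g) (b : V h),
    B.form g h e (toEquiv g a) (toEquiv h b) = A.form g h e a b
  map_act : ∀ g h h' e (a : V h),
    toEquiv h' (A.act g h h' e a) = B.act g h h' e (toEquiv h a)
  map_char : ∀ g, A.char g = B.char g

/-! ### Structure maps on the total space `⨁ g, V g` -/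

open scoped Classical in
/-- The inclusion of a homogeneous component in the total space. -/
def Data.incl (_A : Data k G V) (g : G) : V g →ₗ[k] ⨁ g, V g := DirectSum.lof k G V g

open scoped Classical in
/-- The multiplication on the total space. -/
def Data.totalMul (A : Data k G V) : (⨁ g, V g) →ₗ[k] (⨁ g, V g) →ₗ[k] ⨁ g, V g :=
  DirectSum.toModule k G _ fun g => LinearMap.flip <|
    DirectSum.toModule k G _ fun h => LinearMap.flip <|
      (A.mul g h (g * h) rfl).compr₂ (A.incl (g * h))

open scoped Classical in
/-- The bilinear form on the total space. -/
def Data.totalForm (A : Data k G V) : (⨁ g, V g) →ₗ[k] (⨁ g, V g) →ₗ[k] k :=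
  DirectSum.toModule k G _ fun g => LinearMap.flip <|
    DirectSum.toModule k G _ fun h => LinearMap.flip <|
      if e : g * h = 1 then A.form g h e else 0

open scoped Classical in
/-- The map `φ_g` on the total space. -/
def Data.actBy (A : Data k G V) (g : G) : (⨁ g, V g) →ₗ[k] ⨁ g, V g :=
  DirectSum.toModule k G _ fun h => A.incl (g * h * g⁻¹) ∘ₗ A.act g h (g * h * g⁻¹) rfl

/-- The action `k[G] × A → A` of the group ring on the total space. -/
def Data.totalAct (A : Data k G V) :
    MonoidAlgebra k G →ₗ[k] (⨁ g, V g) →ₗ[k] ⨁ g, V g :=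
  Finsupp.linearCombination k A.actBy ∘ₗ (MonoidAlgebra.coeffLinearEquiv k).toLinearMap

open scoped Classical in
/-- The coaction `ρ : A → A ⊗ k[G]`, `a_g ↦ a_g ⊗ g`. -/
def Data.coact (_A : Data k G V) : (⨁ g, V g) →ₗ[k] (⨁ g, V g) ⊗[k] MonoidAlgebra k G :=
  DirectSum.toModule k G _ fun g =>
    (TensorProduct.mk k _ _).flip (MonoidAlgebra.single g 1) ∘ₗ DirectSum.lof k G V g

/-! ### Twisted group rings, tensor products and twists -/

/-- The twisted group ring `k^α[G]` as a `G`-Frobenius algebra; the component of degree `g` is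
the line `k ĝ`, with `ĝ ĥ = α(g, h) (gh)^`. -/
def twistedGroupRing (α : Z2 G kˣ) : Data k G (fun _ => k) where
  mul g h _ _ := ((α.1 g h : kˣ) : k) • LinearMap.mul k k
  one := 1
  form g h _ := ((α.1 g h : kˣ) : k) • LinearMap.mul k k
  act g h _ _ := ((eps α g h : kˣ) : k) • LinearMap.id
  char _ := 1

/-- The group ring `k[G]` as a `G`-Frobenius algebra; the component of degree `g` is the line
`k g`, the form is `η(g, h) = δ_{gh, e}` and `G` acts by conjugation. -/
def groupRing (k : Type u) [Field k] (G : Type v) [Group G] : Data k G (fun _ => k) where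
  mul _ _ _ _ := LinearMap.mul k k
  one := 1
  form _ _ _ := LinearMap.mul k k
  act _ _ _ _ := LinearMap.id
  char _ := 1

/-- The tensor product of `G`-Frobenius algebras, with components `V g ⊗ W g`. -/
def Data.hatTensor {W : G → Type x} [∀ g, AddCommGroup (W g)] [∀ g, Module k (W g)]
    (A : Data k G V) (B : Data k G W) : Data k G (fun g => V g ⊗[k] W g) where
  mul g h l e := TensorProduct.map₂ (A.mul g h l e) (B.mul g h l e)
  one := A.one ⊗ₜ[k] B.one
  form g h e :=
    (TensorProduct.map₂ (A.form g h e) (B.form g h e)).compr₂ (TensorProduct.lid k k).toLinearMap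
  act g h h' e := TensorProduct.map (A.act g h h' e) (B.act g h h' e)
  char g := A.char g * B.char g

/-- The twist `A_α` of `A` by `α`: the tensor product of `A` with `k^α[G]`. -/
def Data.twist (A : Data k G V) (α : Z2 G kˣ) : Data k G (fun g => V g ⊗[k] k) :=
  A.hatTensor (twistedGroupRing α)

/-! ### Crossed products and push-downs -/

section Crossed

variable {H : Type x} [CommGroup H] {W : H → Type y}
  [∀ h, AddCommGroup (W h)] [∀ h, Module k (W h)]

/-- The crossed product `A #_α B` with components `V g ⊗ W h` in degree `(h, g)`, where
`τ(h) : W h' → W (h h')` is the shift action of `H` on the `H`-Frobenius algebra `B`.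
The metric is `η(a, c) η'(τ(α(g, g')) b, d)`, which pairs the degrees inverse in `G^α`, and
the action is `φ_g(c) ⊗ τ(ε(g, g')) φ'_h(d)`, of degree the conjugate in `G^α`. -/
def Data.crossed (A : Data k G V) (B : Data k H W)
    (τ : ∀ h h' h'' : H, h * h' = h'' → (W h' →ₗ[k] W h'')) (α : Z2 G H) :
    Data k (Ext α) (fun γ => V γ.quo ⊗[k] W γ.ker) where
  mul γ δ ω e := TensorProduct.map₂
    (A.mul γ.quo δ.quo ω.quo (congrArg Ext.quo e))
    ((B.mul γ.ker δ.ker (γ.ker * δ.ker) rfl).compr₂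
      (τ (α.1 γ.quo δ.quo) (γ.ker * δ.ker) ω.ker
        ((mul_comm _ _).trans (congrArg Ext.ker e))))
  one := A.one ⊗ₜ[k] B.one
  form γ δ e := (TensorProduct.map₂
    (A.form γ.quo δ.quo (congrArg Ext.quo e))
    (B.form (α.1 γ.quo δ.quo * γ.ker) δ.ker
        (by have := congrArg Ext.ker e
            rw [← one_ker (α := α), ← this, mul_ker, mul_assoc, mul_comm]) ∘ₗ
      τ (α.1 γ.quo δ.quo) γ.ker (α.1 γ.quo δ.quo * γ.ker) rfl)).compr₂
    (TensorProduct.lid k k).toLinearMap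
  act γ δ ω e := TensorProduct.map
    (A.act γ.quo δ.quo ω.quo (congrArg Ext.quo e))
    (τ (eps α γ.quo δ.quo) (γ.ker * δ.ker * γ.ker⁻¹) ω.ker
        (by rw [mul_inv_cancel_comm, conj_ker e]) ∘ₗ
      B.act γ.ker δ.ker (γ.ker * δ.ker * γ.ker⁻¹) rfl)
  char γ := A.char γ.quo * B.char γ.ker

/-- The linear map `A #_α B → ⨁ g, A_g ⊗ B_e` with `a ⊗ τ(h) b_e ↦ χ(h) a ⊗ b_e`, on the
component of degree `γ`. -/
def pushMap (V : G → Type w) [∀ g, AddCommGroup (V g)] [∀ g, Module k (V g)]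
    (τ : ∀ h h' h'' : H, h * h' = h'' → (W h' →ₗ[k] W h'')) {α : Z2 G H} (χ : H →* kˣ)
    (γ : Ext α) : V γ.quo ⊗[k] W γ.ker →ₗ[k] V γ.quo ⊗[k] W 1 :=
  ((χ γ.ker : kˣ) : k) •
    TensorProduct.map LinearMap.id (τ γ.ker⁻¹ γ.ker 1 (inv_mul_cancel _))

/-- The inverse of `pushMap` on the component of degree `γ`. -/
def pushInv (V : G → Type w) [∀ g, AddCommGroup (V g)] [∀ g, Module k (V g)]
    (τ : ∀ h h' h'' : H, h * h' = h'' → (W h' →ₗ[k] W h'')) {α : Z2 G H} (χ : H →* kˣ)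
    (γ : Ext α) : V γ.quo ⊗[k] W 1 →ₗ[k] V γ.quo ⊗[k] W γ.ker :=
  (((χ γ.ker)⁻¹ : kˣ) : k) •
    TensorProduct.map LinearMap.id (τ γ.ker 1 γ.ker (mul_one _))

/-- The push-down `(A #_α B)^χ`: the structure on `⨁ g, A_g ⊗ B_e` (the components of
`A #_α B` of degree `s(g)`) induced by `pushMap`.  The multiplication and the action are those
of `A #_α B` followed by `pushMap`; the form is the one for which `pushMap` is isometric on the
components of degrees `γ` and `γ⁻¹`. -/
def Data.pushDown (A : Data k G V) (B : Data k H W)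
    (τ : ∀ h h' h'' : H, h * h' = h'' → (W h' →ₗ[k] W h'')) (α : Z2 G H) (χ : H →* kˣ) :
    Data k G (fun g => V g ⊗[k] W 1) where
  mul g h l e := ((A.crossed B τ α).mul (sec α g) (sec α h) ⟨α.1 g h, l⟩ (sec_mul e)).compr₂
    (pushMap V τ χ ⟨α.1 g h, l⟩)
  one := A.one ⊗ₜ[k] B.one
  form g h e := ((A.crossed B τ α).form (sec α g) ⟨(α.1 g h)⁻¹, h⟩ (sec_mul_eq_one e)).compl₂
    (pushInv V τ χ ⟨(α.1 g h)⁻¹, h⟩)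
  act g h h' e := pushMap V τ χ ⟨eps α g h, h'⟩ ∘ₗ
    (A.crossed B τ α).act (sec α g) (sec α h) ⟨eps α g h, h'⟩ (sec_conj e)
  char g := (A.crossed B τ α).char (sec α g)

end Crossed

section Lift

variable {H : Type x} [CommGroup H]

/-- The shift action of `H` on `k[H]` by left translation, `τ(h) (r h') = r (h h')`. -/
def groupRingShift (k : Type u) [Field k] (H : Type x) [CommGroup H] :
    ∀ h h' h'' : H, h * h' = h'' → (k →ₗ[k] k) := fun _ _ _ _ => LinearMap.id

/-- The `G^α`-Frobenius algebra `A^α = A #_α k[H]`. -/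
def Data.extend (A : Data k G V) (α : Z2 G H) : Data k (Ext α) (fun γ => V γ.quo ⊗[k] k) :=
  A.crossed (groupRing k H) (groupRingShift k H) α

/-- The push-down `(A^α)^χ` of `A^α = A #_α k[H]` along `χ`. -/
def Data.extendPush (A : Data k G V) (α : Z2 G H) (χ : H →* kˣ) :
    Data k G (fun g => V g ⊗[k] k) :=
  A.pushDown (groupRing k H) (groupRingShift k H) α χ

/-- The linear map `k[G^α] → k[G]`, `(h, g) ↦ χ(h) g`. -/
def chiMap (α : Z2 G H) (χ : H →* kˣ) : MonoidAlgebra k (Ext α) →ₗ[k] MonoidAlgebra k G :=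
  Finsupp.linearCombination k
      (fun γ : Ext α => (MonoidAlgebra.single γ.quo ((χ γ.ker : kˣ) : k) : MonoidAlgebra k G)) ∘ₗ
    (MonoidAlgebra.coeffLinearEquiv k).toLinearMap

/-- The linear map `k[G] → k[G^α]`, `g ↦ s(g)`. -/
def secMap (k : Type u) [Field k] (α : Z2 G H) :
    MonoidAlgebra k G →ₗ[k] MonoidAlgebra k (Ext α) :=
  Finsupp.linearCombination k
      (fun g : G => (MonoidAlgebra.single (sec α g) 1 : MonoidAlgebra k (Ext α))) ∘ₗ
    (MonoidAlgebra.coeffLinearEquiv k).toLinearMap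

/-- Linear maps `i : F → E` and `res : E → F` which exhibit the `G^α`-Frobenius algebra `E` as a
lift of the `G`-Frobenius algebra `F` along `χ`. -/
structure LiftMaps {U : G → Type w} [∀ g, AddCommGroup (U g)] [∀ g, Module k (U g)]
    {α : Z2 G H} {W : Ext α → Type y} [∀ γ, AddCommGroup (W γ)] [∀ γ, Module k (W γ)]
    (χ : H →* kˣ) (F : Data k G U) (E : Data k (Ext α) W) where
  i : (⨁ g, U g) →ₗ[k] ⨁ γ, W γ
  res : (⨁ γ, W γ) →ₗ[k] ⨁ g, U g
  /-- The three diagrams for the coaction, the multiplication and the action. -/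
  coact_diagram : TensorProduct.map res (chiMap α χ) ∘ₗ E.coact ∘ₗ i = F.coact
  mul_diagram : ∀ a b, res (E.totalMul (i a) (i b)) = F.totalMul a b
  act_diagram : ∀ (r : MonoidAlgebra k G) a, res (E.totalAct (secMap k α r) (i a)) =
    F.totalAct r a
  /-- Compatibility with the gradings, along `s` and `π`. -/
  i_degree : ∀ g (a : U g), ∃ b : W (sec α g), i (F.incl g a) = E.incl (sec α g) b
  res_degree : ∀ γ (b : W γ), ∃ a : U γ.quo, res (E.incl γ b) = F.incl γ.quo a
  /-- Compatibility with the units. -/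
  i_one : i (F.incl 1 F.one) = E.incl 1 E.one
  res_one : res (E.incl 1 E.one) = F.incl 1 F.one
  /-- `res` is multiplicative, and equivariant along `π`. -/
  res_mul : ∀ a b, res (E.totalMul a b) = F.totalMul (res a) (res b)
  res_act : ∀ γ a, res (E.actBy γ a) = F.actBy γ.quo (res a)
  /-- `res` is isometric on components of inverse degrees. -/
  res_form : ∀ γ δ (_ : γ * δ = 1) (a : W γ) (b : W δ),
    F.totalForm (res (E.incl γ a)) (res (E.incl δ b)) = E.totalForm (E.incl γ a) (E.incl δ b)
  /-- Compatibility with the characters. -/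
  char_eq : ∀ γ, E.char γ = F.char γ.quo

end Lift

end Algebra

/-! ### Projective representations and universal extensions -/

/-- A projective representation of `G` on `k^n`. -/
def IsProjRep {k : Type u} [Field k] {G : Type v} [Group G] {n : ℕ} (ρ : G → GL (Fin n) k) :
    Prop :=
  ρ 1 = 1 ∧ ∀ g h, ∃ c : kˣ, (ρ g * ρ h).val = (c : k) • (ρ (g * h)).val

/-- The projective representation `ρ` of `G` lifts to a linear representation of `G^β`, i.e.
there is a linear representation of `G^β` which agrees with `ρ ∘ π` up to scalars. -/
def ProjRepLifts {k : Type u} [Field k] {G : Type v} [Group G] {H : Type w} [CommGroup H]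
    (β : Z2 G H) {n : ℕ} (ρ : G → GL (Fin n) k) : Prop :=
  ∃ R : Ext β →* GL (Fin n) k, ∀ γ, ∃ c : kˣ, (R γ).val = (c : k) • (ρ γ.quo).val

/-- The central extension `G^β` of `G` by `H` is a universal extension (representation group)
of `G` over `k`: `H ≅ H²(G, kˣ)` and every projective representation of `G` lifts to `G^β`. -/
def IsUniversalExtension (k : Type u) [Field k] {G : Type v} [Group G] {H : Type w} [CommGroup H]
    (β : Z2 G H) : Prop :=
  Nonempty (H ≃* H2 G kˣ) ∧
    ∀ (n : ℕ) (ρ : G → GL (Fin n) k), IsProjRep ρ → ProjRepLifts β ρ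

end GFrob

end

/-! Twist and extension are two cases of one construction. For a homomorphism `π : Γ → G` and a
cocycle `α` on `Γ`, the spaces `V (π γ)` carry the structure maps of `A` multiplied by values of `α`
and of `ε_α` (`Data.pullback`). Each axiom then splits into the same axiom for `A` and an identity
of scalars, so one verification, `Data.pullback_isGFrobenius`, suffices. Taking `π = id` gives
`A_α`; taking the projection `G^{α'} → G` with trivial cocycle gives `A^{α'}`. If `α = χ ∘ α'`, the
push-down has the same components and the same structure maps as `A_α`, hence inherits the axioms
from it.

Lifting needs less than `α = χ ∘ β`: it suffices that `α = (χ ∘ β) · dν` for some `ν : G → kˣ`. Then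
`i` multiplies degree `g` by `ν(g)`, `res` multiplies degree `(h, g)` by `χ(h) ν(g)⁻¹`, and `res ∘ i
= id` (`Data.liftMaps`).

For a universal extension such `χ` and `ν` come from the regular representation of `k^α[G]`, a
projective representation with cocycle `α`. Its lift to `G^β` differs from it by scalars `c(γ)`;
then `χ` is the restriction of `c` to `H`, and `ν(g) = c(s(g))⁻¹`
(`IsUniversalExtension.exists_character`). -/

noncomputable section

namespace GFrob

/-! ### Identities for `ε`, read off from conjugation in the central extension. -/

section Cocycles

variable {G : Type v} {H : Type w} [Group G] [CommGroup H] (α : Z2 G H)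

@[simp] theorem Z2.one_left (g : G) : α.1 1 g = 1 := α.2.2.1 g

@[simp] theorem Z2.one_right (g : G) : α.1 g 1 = 1 := α.2.2.2 g

/-- Conjugation in `G^α` changes the `H`-component exactly by `ε`. The identities for `ε` below are
therefore `H`-components of identities valid in any group. -/
theorem eps_mul_ker (γ δ : Ext α) : eps α γ.quo δ.quo * δ.ker = (γ * δ * γ⁻¹).ker := conj_ker rfl

@[simp] theorem eps_self (g : G) : eps α g g = 1 := by simp [eps]

@[simp] theorem eps_one_left (h : G) : eps α 1 h = 1 := by simp [eps]

@[simp] theorem eps_one_right (g : G) : eps α g 1 = 1 := by simp [eps]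

/-- Conjugation by a product is the composite of the conjugations, applied to sections in `G^α`. -/
theorem eps_mul_left (g g' h : G) :
    eps α (g * g') h = eps α g (g' * h * g'⁻¹) * eps α g' h := by
  have h1 := eps_mul_ker α (sec α g * sec α g') (sec α h)
  have h2 := eps_mul_ker α (sec α g) (sec α g' * sec α h * (sec α g')⁻¹)
  rw [← eps_mul_ker α (sec α g') (sec α h)] at h2
  have h3 : sec α g * sec α g' * sec α h * (sec α g * sec α g')⁻¹ =
    sec α g * (sec α g' * sec α h * (sec α g')⁻¹) * (sec α g)⁻¹ := by group
  rw [h3, ← h2] at h1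
  simpa [sec] using h1

/-- Conjugation by `s(g)` is multiplicative on `s(h) s(l)`. -/
theorem eps_mul_right (g h l : G) :
    eps α g (h * l) * α.1 h l =
      α.1 (g * h * g⁻¹) (g * l * g⁻¹) * (eps α g h * eps α g l) := by
  have h1 := eps_mul_ker α (sec α g) (sec α h * sec α l)
  have h2 : sec α g * (sec α h * sec α l) * (sec α g)⁻¹ =
    (sec α g * sec α h * (sec α g)⁻¹) * (sec α g * sec α l * (sec α g)⁻¹) := by group
  rw [h2, mul_ker _ (sec α g * sec α l * (sec α g)⁻¹), ← eps_mul_ker, ← eps_mul_ker] at h1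
  simpa [sec, mul_comm] using h1

theorem eq_mul_eps (g h : G) : α.1 g h = α.1 (g * h * g⁻¹) g * eps α g h := by
  simp [eps]

/-- The identity of scalars behind the trace axiom of the twisted group ring. -/
theorem mul_eps_commutator (g h : G) :
    α.1 (g * h * g⁻¹ * h⁻¹) (h * g * h⁻¹) * eps α h g =
      eps α g⁻¹ (g * h * g⁻¹) * α.1 (g * h * g⁻¹ * h⁻¹) h := by
  set c := g * h * g⁻¹ * h⁻¹ with hc
  have h1 : α.1 h g = α.1 (h * g * h⁻¹) h * eps α h g := eq_mul_eps α h g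
  -- The two cocycle identities share the term `α(c, hg)`, because `hgh⁻¹ · h = hg`. Solving each
  -- for its first factor makes the two sides comparable.
  have h2 := α.2.1 c (h * g * h⁻¹) h
  have h3 := α.2.1 c h g
  have h4 : eps α g⁻¹ (g * h * g⁻¹) * eps α g h = 1 := by
    have := eps_mul_left α g⁻¹ g h
    rw [inv_mul_cancel, eps_one_left] at this
    exact this.symm
  have h5 := eq_mul_eps α g h
  have e1 : c * (h * g * h⁻¹) = g := by rw [hc]; group
  have e2 : c * h = g * h * g⁻¹ := by rw [hc]; group
  have e3 : h * g * h⁻¹ * h = h * g := by group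
  rw [e1, e3] at h2
  rw [e2] at h3
  have h6 : eps α g⁻¹ (g * h * g⁻¹) = (eps α g h)⁻¹ := eq_inv_of_mul_eq_one_left h4
  rw [h6]
  have h7 : α.1 c (h * g * h⁻¹) = α.1 (h * g * h⁻¹) h * α.1 c (h * g) * (α.1 g h)⁻¹ := by
    rw [← h2]; simp
  have h8 : α.1 c h = α.1 h g * α.1 c (h * g) * (α.1 (g * h * g⁻¹) g)⁻¹ := by
    rw [← h3]; simp
  rw [h7, h8, h5, h1]
  simp only [mul_inv]
  ac_rfl

end Cocycles

/-! ### Twisted pullbacks, and invariance of the axioms under isomorphism. -/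

section Pullback

variable {k : Type u} [Field k] {G : Type v} [Group G] {V : G → Type w}
  [∀ g, AddCommGroup (V g)] [∀ g, Module k (V g)]

/-- The twist by a cocycle `α` of the pullback of a `G`-Frobenius algebra along `π : Γ →* G`,
on the components `V (π γ)`. -/
def Data.pullback {Γ : Type x} [Group Γ] (A : Data k G V) (π : Γ →* G) (α : Z2 Γ kˣ) :
    Data k Γ (fun γ => V (π γ)) where
  mul g h l e := ((α.1 g h : kˣ) : k) • A.mul (π g) (π h) (π l) (by rw [← e, map_mul])
  -- `φ_1` serves as the transport from `V 1` to `V (π 1)`, which need not be definitionally equal.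
  one := (A.act 1 1 (π 1) (by simp)) A.one
  form g h e := ((α.1 g h : kˣ) : k) • A.form (π g) (π h) (by rw [← map_mul, e, map_one])
  act g h h' e := ((eps α g h : kˣ) : k) • A.act (π g) (π h) (π h') (by simp [← e])
  char g := A.char (π g)

/-- The scalars match by the cocycle identity (associativity, invariance of the form), the
definition of `ε` (twisted commutativity), `eps_mul_left` (action), `eps_mul_right` (equivariance of
product and form) and `mul_eps_commutator` (trace). The character is untouched. -/
theorem Data.pullback_isGFrobenius {Γ : Type x} [Group Γ] [Finite Γ] {A : Data k G V}
    (hA : A.IsGFrobenius) (π : Γ →* G) (α : Z2 Γ kˣ) : (A.pullback π α).IsGFrobenius where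
  finite_group := ‹_›
  finite_dim g := hA.finite_dim (π g)
  nondegenerate g h e := by
    have h0 := hA.nondegenerate (π g) (π h) (by rw [← map_mul, e, map_one])
    refine ⟨fun a ha => h0.1 a fun b => ?_, fun b hb => h0.2 b fun a => ?_⟩
    · simpa [Data.pullback] using ha b
    · simpa [Data.pullback] using hb a
  act_one h e a := by
    have := hA.act_one (π h) (by simp) a
    simpa [Data.pullback] using this
  act_mul g g' h h' h'' e e' e'' a := by
    subst e'' e
    have := hA.act_mul (π g) (π g') (π h) (π (g' * h * g'⁻¹)) (π (g * g' * h * (g * g')⁻¹))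
      (by simp) (by simp [mul_assoc]) (by simp) a
    simp only [Data.pullback, LinearMap.smul_apply, map_smul, smul_smul, ← this, eps_mul_left,
      ← Units.val_mul, map_mul]
    rw [mul_comm]
  char_mul g h := by simp [Data.pullback, hA.char_mul]
  mul_assoc g h l gh hl ghl e₁ e₂ e₃ e₄ a b c := by
    subst e₁ e₃ e₂
    have := hA.mul_assoc (π g) (π h) (π l) (π (g * h)) (π (h * l)) (π (g * h * l))
      (by simp) (by simp) (by simp) (by simp [_root_.mul_assoc]) a b c
    simp only [Data.pullback, LinearMap.smul_apply, map_smul, smul_smul, this, ← Units.val_mul]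
    rw [mul_comm (α.1 _ l), α.2.1, mul_comm (α.1 h l)]
  twisted_comm g h l h' e₁ e₂ e₃ a b := by
    subst e₃ e₁
    have := hA.twisted_comm (π g) (π h) (π (g * h)) (π (g * h * g⁻¹))
      (by simp) (by simp) (by simp) a b
    simp only [Data.pullback, LinearMap.smul_apply, map_smul, smul_smul, this, ← Units.val_mul]
    rw [eq_mul_eps, mul_comm]
  one_mul g e a := by
    -- With `π 1` replaced by a variable `x`, the equation `x = 1` can be substituted, and the
    -- transport `φ_1` disappears.
    have key : ∀ x (e₁ : x * π g = π g) (e₂ : 1 * 1 * 1⁻¹ = x),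
        A.mul x (π g) (π g) e₁ (A.act 1 1 x e₂ A.one) a = a := by
      intro x e₁ e₂
      obtain rfl : x = 1 := by simpa using e₁
      rw [hA.act_one, hA.one_mul]
    simpa [Data.pullback] using key _ _ _
  mul_one g e a := by
    have key : ∀ x (e₁ : π g * x = π g) (e₂ : 1 * 1 * 1⁻¹ = x),
        A.mul (π g) x (π g) e₁ a (A.act 1 1 x e₂ A.one) = a := by
      intro x e₁ e₂
      obtain rfl : x = 1 := by simpa using e₁
      rw [hA.act_one, hA.mul_one]
    simpa [Data.pullback] using key _ _ _
  act_unit g e := by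
    have key : ∀ x (e₁ : π g * x * (π g)⁻¹ = x) (e₂ : 1 * 1 * 1⁻¹ = x),
        A.act (π g) x x e₁ (A.act 1 1 x e₂ A.one) = A.act 1 1 x e₂ A.one := by
      intro x e₁ e₂
      obtain rfl : x = 1 := by simpa using e₂.symm
      rw [hA.act_one, hA.act_unit]
    simpa [Data.pullback] using key _ _ _
  form_mul g h l gh hl e₁ e₂ e₃ e₄ a b c := by
    subst e₂ e₄
    have := hA.form_mul (π g) (π h) (π l) (π (g * h)) (π (h * l))
      (by rw [← map_mul, e₁, map_one]) (by simp) (by rw [← map_mul, e₃, map_one]) (by simp) a b c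
    simp only [Data.pullback, LinearMap.smul_apply, map_smul, smul_smul, this, ← Units.val_mul]
    rw [mul_comm (α.1 g _), ← α.2.1, mul_comm (α.1 g h)]
  self_invariance g e a := by
    have := hA.self_invariance (π g) (by simp) a
    simpa [Data.pullback] using this
  act_map_mul g h l hl h' l' hl' e₁ e₂ e₃ e₄ e₅ a b := by
    subst e₁ e₂ e₄ e₅
    have := hA.act_map_mul (π g) (π h) (π l) (π (h * l)) (π (g * h * g⁻¹)) (π (g * l * g⁻¹))
      (π (g * (h * l) * g⁻¹)) (by simp) (by simp) (by simp) (by simp) (by simp) a b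
    simp only [Data.pullback, LinearMap.smul_apply, map_smul, smul_smul, this, ← Units.val_mul]
    rw [mul_comm, eps_mul_right]
    congr 2
    ac_rfl
  form_act g h l h' l' e₁ e₂ e₃ e₄ a b := by
    subst e₂ e₃
    have := hA.form_act (π g) (π h) (π l) (π (g * h * g⁻¹)) (π (g * l * g⁻¹))
      (by rw [← map_mul, e₁, map_one]) (by simp) (by simp) (by rw [← map_mul, e₄, map_one]) a b
    -- As `hl = 1`, the factor `ε(g, hl)` is trivial: `α` contributes the same scalar on both sides,
    -- and `ξ_g⁻²` comes from `A` alone.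
    have h1 := eps_mul_right α g h l
    rw [e₄, eps_one_right, _root_.one_mul] at h1
    simp only [Data.pullback, LinearMap.smul_apply, map_smul, smul_smul, this, smul_eq_mul, h1]
    push_cast
    ring
  trace g h c h' g' e₁ e₂ e₃ e₄ a := by
    -- The degree equations force `c` to be the commutator.
    obtain rfl : c = g * h * g⁻¹ * h⁻¹ := by
      rw [← eq_mul_inv_iff_mul_eq] at e₂
      rw [e₂, ← e₁]; group
    have e₅ : g' = g * h * g⁻¹ := by rw [← e₃]; group
    subst e₁ e₅
    have h1 := mul_eps_commutator α g h
    have := hA.trace (π g) (π h) (π (g * h * g⁻¹ * h⁻¹)) (π (h * g * h⁻¹)) (π (g * h * g⁻¹))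
      (by simp) (by rw [← map_mul, e₂]) (by rw [← map_mul, e₃])
      (by rw [← map_inv, ← map_mul, ← map_inv, ← map_mul, e₄]) a
    simp only [Data.pullback, LinearMap.smul_apply, LinearMap.smul_comp, LinearMap.comp_smul,
      map_smul, smul_smul, ← Units.val_mul]
    rw [mul_comm (eps α h g), h1, mul_comm (α.1 _ h)]
    simp only [smul_eq_mul]
    rw [mul_left_comm, this]
    simp only [map_inv]
    ring

/-- The axioms of a `G`-Frobenius algebra are invariant under isomorphisms. -/
theorem Data.Iso.isGFrobenius {W : G → Type x} [∀ g, AddCommGroup (W g)] [∀ g, Module k (W g)]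
    {A : Data k G V} {B : Data k G W} (f : A.Iso B) (hA : A.IsGFrobenius) : B.IsGFrobenius := by
  have hmul : ∀ g h l e (a : W g) (b : W h), B.mul g h l e a b =
      f.toEquiv l (A.mul g h l e ((f.toEquiv g).symm a) ((f.toEquiv h).symm b)) := by
    intros; simp [f.map_mul]
  have hform : ∀ g h e (a : W g) (b : W h), B.form g h e a b =
      A.form g h e ((f.toEquiv g).symm a) ((f.toEquiv h).symm b) := by
    intros; simp [← f.map_form]
  have hact : ∀ g h h' e (a : W h), B.act g h h' e a =
      f.toEquiv h' (A.act g h h' e ((f.toEquiv h).symm a)) := by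
    intros; simp [f.map_act]
  exact
  { finite_group := hA.finite_group
    finite_dim := fun g => by
      have := hA.finite_dim g
      exact Module.Finite.equiv (f.toEquiv g)
    nondegenerate := fun g h e => by
      have h0 := hA.nondegenerate g h e
      refine ⟨fun a ha => ?_, fun b hb => ?_⟩
      · have := h0.1 ((f.toEquiv g).symm a) fun b => by
          simpa [hform] using ha (f.toEquiv h b)
        simpa using this
      · have := h0.2 ((f.toEquiv h).symm b) fun a => by
          simpa [hform] using hb (f.toEquiv g a)
        simpa using this
    act_one := fun h e a => by simp [hact, hA.act_one]
    act_mul := fun g g' h h' h'' e e' e'' a => by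
      simp [hact, hA.act_mul g g' h h' h'' e e' e'']
    char_mul := fun g h => by simp [← f.map_char, hA.char_mul]
    mul_assoc := fun g h l gh hl ghl e₁ e₂ e₃ e₄ a b c => by
      simp [hmul, hA.mul_assoc g h l gh hl ghl e₁ e₂ e₃ e₄]
    twisted_comm := fun g h l h' e₁ e₂ e₃ a b => by
      simp [hmul, hact, hA.twisted_comm g h l h' e₁ e₂ e₃]
    one_mul := fun g e a => by simp [hmul, ← f.map_one, hA.one_mul]
    mul_one := fun g e a => by simp [hmul, ← f.map_one, hA.mul_one]
    act_unit := fun g e => by simp [hact, ← f.map_one, hA.act_unit]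
    form_mul := fun g h l gh hl e₁ e₂ e₃ e₄ a b c => by
      simp [hmul, hform, hA.form_mul g h l gh hl e₁ e₂ e₃ e₄]
    self_invariance := fun g e a => by
      simp [hact, ← f.map_char, hA.self_invariance]
    act_map_mul := fun g h l hl h' l' hl' e₁ e₂ e₃ e₄ e₅ a b => by
      simp [hmul, hact, hA.act_map_mul g h l hl h' l' hl' e₁ e₂ e₃ e₄ e₅]
    form_act := fun g h l h' l' e₁ e₂ e₃ e₄ a b => by
      simp [hform, hact, ← f.map_char, hA.form_act g h l h' l' e₁ e₂ e₃ e₄]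
    trace := fun g h c h' g' e₁ e₂ e₃ e₄ a => by
      -- The operators for `B` are conjugates of those for `A`, so they have the same traces.
      have h1 : B.mul c h' g e₂ a ∘ₗ B.act h g h' e₁ = (f.toEquiv g).conj
          (A.mul c h' g e₂ ((f.toEquiv c).symm a) ∘ₗ A.act h g h' e₁) := by
        ext; simp [hmul, hact, LinearEquiv.conj_apply]
      have h2 : B.act g⁻¹ g' h e₄ ∘ₗ B.mul c h g' e₃ a = (f.toEquiv h).conj
          (A.act g⁻¹ g' h e₄ ∘ₗ A.mul c h g' e₃ ((f.toEquiv c).symm a)) := by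
        ext; simp [hmul, hact, LinearEquiv.conj_apply]
      rw [h1, h2, LinearMap.trace_conj', LinearMap.trace_conj', ← f.map_char, ← f.map_char]
      exact hA.trace g h c h' g' e₁ e₂ e₃ e₄ _ }

/-- The inverse of an isomorphism of `G`-Frobenius algebras. -/
def Data.Iso.symm {W : G → Type x} [∀ g, AddCommGroup (W g)] [∀ g, Module k (W g)]
    {A : Data k G V} {B : Data k G W} (f : A.Iso B) : B.Iso A where
  toEquiv g := (f.toEquiv g).symm
  map_mul g h l e a b := by simp [LinearEquiv.symm_apply_eq, f.map_mul]
  map_one := by simp [LinearEquiv.symm_apply_eq, f.map_one]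
  map_form g h e a b := by simp [← f.map_form]
  map_act g h h' e a := by simp [LinearEquiv.symm_apply_eq, f.map_act]
  map_char g := (f.map_char g).symm

/-! ### The twist as a pullback along the identity. -/

section Twist

variable (A : Data k G V) (α : Z2 G kˣ)

@[simp] theorem Data.twist_mul_tmul (g h l : G) (e : g * h = l) (a : V g) (b : V h) (r s : k) :
    (A.twist α).mul g h l e (a ⊗ₜ r) (b ⊗ₜ s) =
      A.mul g h l e a b ⊗ₜ (((α.1 g h : kˣ) : k) * (r * s)) := rfl

@[simp] theorem Data.twist_form_tmul (g h : G) (e : g * h = 1) (a : V g) (b : V h) (r s : k) :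
    (A.twist α).form g h e (a ⊗ₜ r) (b ⊗ₜ s) =
      A.form g h e a b * (((α.1 g h : kˣ) : k) * (r * s)) := rfl

@[simp] theorem Data.twist_act_tmul (g h h' : G) (e : g * h * g⁻¹ = h') (a : V h) (r : k) :
    (A.twist α).act g h h' e (a ⊗ₜ r) =
      A.act g h h' e a ⊗ₜ (((eps α g h : kˣ) : k) * r) := rfl

@[simp] theorem Data.twist_char (g : G) : (A.twist α).char g = A.char g := mul_one _

variable {A} in
/-- The twist `A_α` is isomorphic to the same spaces with structure maps scaled by `α`. -/
def Data.pullbackIsoTwist (hA : A.IsGFrobenius) :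
    (A.pullback (MonoidHom.id G) α).Iso (A.twist α) where
  toEquiv g := (TensorProduct.rid k (V g)).symm
  map_mul g h l e a b := by
    refine Eq.trans ?_ (A.twist_mul_tmul α g h l e a b 1 1).symm
    rw [mul_one, mul_one, ← mul_one ((α.1 g h : kˣ) : k), ← smul_eq_mul, ← TensorProduct.smul_tmul]
    rfl
  map_one := congrArg (· ⊗ₜ[k] (1 : k)) (hA.act_one 1 _ A.one)
  map_form g h e a b := by
    refine (A.twist_form_tmul α g h e a b 1 1).trans ?_
    rw [mul_one, mul_one, mul_comm]
    rfl
  map_act g h h' e a := by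
    refine Eq.trans ?_ (A.twist_act_tmul α g h h' e a 1).symm
    rw [← smul_eq_mul, ← TensorProduct.smul_tmul]
    rfl
  map_char g := (A.twist_char α g).symm

end Twist

/-! ### The extension as a pullback along the projection, and the push-down. -/

section Ext

variable {H : Type x} [CommGroup H]

/-- The projection `π : G^α → G`. -/
def Ext.proj (α : Z2 G H) : Ext α →* G where
  toFun := Ext.quo
  map_one' := rfl
  map_mul' _ _ := rfl

instance [Finite G] [Finite H] (α : Z2 G H) : Finite (Ext α) :=
  Finite.of_injective (fun γ : Ext α => (γ.ker, γ.quo)) fun γ δ h => by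
    ext <;> simp_all

section Extend

variable (A : Data k G V) (α : Z2 G H)

@[simp] theorem Data.extend_mul_tmul (γ δ ω : Ext α) (e : γ * δ = ω) (a : V γ.quo) (b : V δ.quo)
    (r s : k) : (A.extend α).mul γ δ ω e (a ⊗ₜ r) (b ⊗ₜ s) =
      A.mul γ.quo δ.quo ω.quo (congrArg Ext.quo e) a b ⊗ₜ (r * s) := rfl

@[simp] theorem Data.extend_form_tmul (γ δ : Ext α) (e : γ * δ = 1) (a : V γ.quo) (b : V δ.quo)
    (r s : k) : (A.extend α).form γ δ e (a ⊗ₜ r) (b ⊗ₜ s) =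
      A.form γ.quo δ.quo (congrArg Ext.quo e) a b * (r * s) := rfl

@[simp] theorem Data.extend_act_tmul (γ δ ω : Ext α) (e : γ * δ * γ⁻¹ = ω) (a : V δ.quo) (r : k) :
    (A.extend α).act γ δ ω e (a ⊗ₜ r) =
      A.act γ.quo δ.quo ω.quo (congrArg Ext.quo e) a ⊗ₜ r := rfl

@[simp] theorem Data.extend_char (γ : Ext α) : (A.extend α).char γ = A.char γ.quo := mul_one _

variable {A} in
/-- `A^α` is isomorphic to the pullback of `A` along `π : G^α → G`. -/
def Data.pullbackIsoExtend (hA : A.IsGFrobenius) :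
    (A.pullback (Ext.proj α) 1).Iso (A.extend α) where
  toEquiv γ := (TensorProduct.rid k (V γ.quo)).symm
  map_mul γ δ ω e a b := by
    refine Eq.trans ?_ (A.extend_mul_tmul α γ δ ω e a b 1 1).symm
    rw [mul_one]
    exact congrArg (· ⊗ₜ[k] (1 : k)) (one_smul k _)
  map_one := congrArg (· ⊗ₜ[k] (1 : k)) (hA.act_one 1 _ A.one)
  map_form γ δ e a b := by
    refine (A.extend_form_tmul α γ δ e a b 1 1).trans ?_
    rw [mul_one, mul_one]
    exact (one_smul k _).symm
  map_act γ δ ω e a := by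
    refine Eq.trans ?_ (A.extend_act_tmul α γ δ ω e a 1).symm
    refine congrArg (· ⊗ₜ[k] (1 : k)) ?_
    have : eps (1 : Z2 (Ext α) kˣ) γ δ = 1 := by simp [eps]
    simp only [Data.pullback, this]
    exact one_smul k _
  map_char γ := (A.extend_char α γ).symm

end Extend

theorem Data.IsGFrobenius.twist {A : Data k G V} (hA : A.IsGFrobenius) (α : Z2 G kˣ) :
    (A.twist α).IsGFrobenius :=
  have := hA.finite_group
  (Data.pullbackIsoTwist α hA).isGFrobenius (Data.pullback_isGFrobenius hA _ α)

theorem Data.IsGFrobenius.extend [Finite H] {A : Data k G V} (hA : A.IsGFrobenius) (α : Z2 G H) :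
    (A.extend α).IsGFrobenius :=
  have := hA.finite_group
  (Data.pullbackIsoExtend α hA).isGFrobenius (Data.pullback_isGFrobenius hA _ 1)

theorem map_eps {α : Z2 G kˣ} {α' : Z2 G H} {χ : H →* kˣ}
    (hχ : ∀ g g', α.1 g g' = χ (α'.1 g g')) (g h : G) : χ (eps α' g h) = eps α g h := by
  simp [eps, hχ]

theorem Data.extendPush_mul_tmul (A : Data k G V) (α : Z2 G H) (χ : H →* kˣ) (g h l : G)
    (e : g * h = l) (a : V g) (b : V h) (r s : k) :
    (A.extendPush α χ).mul g h l e (a ⊗ₜ r) (b ⊗ₜ s) =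
      ((χ (α.1 g h) : kˣ) : k) • (A.mul g h l e a b ⊗ₜ (r * s)) := rfl

/-- The inverse of `s(g)` is `(α(g, h)⁻¹, h)`, in general not `s(h)`. The second argument is moved
to that degree by `pushInv`, which produces the inverse value of `χ`. -/
theorem Data.extendPush_form_tmul (A : Data k G V) (α : Z2 G H) (χ : H →* kˣ) (g h : G)
    (e : g * h = 1) (a : V g) (b : V h) (r s : k) :
    (A.extendPush α χ).form g h e (a ⊗ₜ r) (b ⊗ₜ s) =
      A.form g h e a b * (r * ((((χ (α.1 g h)⁻¹)⁻¹ : kˣ) : k) * s)) := by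
  rw [← smul_eq_mul _ s]
  have : (A.extendPush α χ).form g h e (a ⊗ₜ r) (b ⊗ₜ s) = (A.extend α).form (sec α g)
    ⟨(α.1 g h)⁻¹, h⟩ (sec_mul_eq_one e) (a ⊗ₜ r)
      ((((χ (α.1 g h)⁻¹)⁻¹ : kˣ) : k) • (b ⊗ₜ[k] s)) := rfl
  rw [this, ← TensorProduct.tmul_smul]
  rfl

theorem Data.extendPush_act_tmul (A : Data k G V) (α : Z2 G H) (χ : H →* kˣ) (g h h' : G)
    (e : g * h * g⁻¹ = h') (a : V h) (r : k) :
    (A.extendPush α χ).act g h h' e (a ⊗ₜ r) =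
      ((χ (eps α g h) : kˣ) : k) • (A.act g h h' e a ⊗ₜ r) := rfl

/-- If `α = χ ∘ α'`, the push-down `(A^{α'})^χ` is the twist `A_α`. -/
def Data.extendPushIsoTwist (A : Data k G V) {α : Z2 G kˣ} {α' : Z2 G H} {χ : H →* kˣ}
    (hχ : ∀ g g', α.1 g g' = χ (α'.1 g g')) : (A.extendPush α' χ).Iso (A.twist α) where
  toEquiv g := LinearEquiv.refl k _
  map_mul g h l e a b := by
    simp only [LinearEquiv.refl_apply]
    induction a with
    | zero => simp
    | add x y hx hy => simp only [map_add, LinearMap.add_apply, hx, hy]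
    | tmul a r =>
    induction b with
    | zero => simp
    | add x y hx hy => simp only [map_add, hx, hy]
    | tmul b s =>
    rw [Data.extendPush_mul_tmul, Data.twist_mul_tmul, hχ, ← TensorProduct.tmul_smul, smul_eq_mul]
  map_one := rfl
  map_form g h e a b := by
    simp only [LinearEquiv.refl_apply]
    induction a with
    | zero => simp
    | add x y hx hy => simp only [map_add, LinearMap.add_apply, hx, hy]
    | tmul a r =>
    induction b with
    | zero => simp
    | add x y hx hy => simp only [map_add, hx, hy]
    | tmul b s =>
    rw [Data.extendPush_form_tmul, Data.twist_form_tmul, hχ, map_inv, inv_inv]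
    ring
  map_act g h h' e a := by
    simp only [LinearEquiv.refl_apply]
    induction a with
    | zero => simp
    | add x y hx hy => simp only [map_add, hx, hy]
    | tmul a r =>
    rw [Data.extendPush_act_tmul, Data.twist_act_tmul, map_eps hχ, ← TensorProduct.tmul_smul,
      smul_eq_mul]
  map_char g := rfl

end Ext

end Pullback

/-! ### Structure maps of the total space on homogeneous elements. -/

section Total

variable {k : Type u} [Field k] {G : Type v} [Group G] {V : G → Type w}
  [∀ g, AddCommGroup (V g)] [∀ g, Module k (V g)] (A : Data k G V)

theorem Data.total_induction {p : (⨁ g, V g) → Prop} (a : ⨁ g, V g) (zero : p 0)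
    (incl : ∀ g (x : V g), p (A.incl g x)) (add : ∀ a b, p a → p b → p (a + b)) : p a := by
  classical
  refine DirectSum.induction_on a zero (fun g x => ?_) add
  convert incl g x
  simp [Data.incl, DirectSum.lof_eq_of]

@[simp] theorem Data.totalMul_incl (g h l : G) (e : g * h = l) (a : V g) (b : V h) :
    A.totalMul (A.incl g a) (A.incl h b) = A.incl l (A.mul g h l e a b) := by
  subst e
  simp [Data.totalMul, Data.incl, DirectSum.toModule_lof]

@[simp] theorem Data.totalForm_incl (g h : G) (e : g * h = 1) (a : V g) (b : V h) :
    A.totalForm (A.incl g a) (A.incl h b) = A.form g h e a b := by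
  simp [Data.totalForm, Data.incl, DirectSum.toModule_lof, e]

@[simp] theorem Data.actBy_incl (g h h' : G) (e : g * h * g⁻¹ = h') (a : V h) :
    A.actBy g (A.incl h a) = A.incl h' (A.act g h h' e a) := by
  subst e
  simp [Data.actBy, Data.incl, DirectSum.toModule_lof]

@[simp] theorem Data.coact_incl (g : G) (a : V g) :
    A.coact (A.incl g a) = A.incl g a ⊗ₜ MonoidAlgebra.single g 1 := by
  simp [Data.coact, Data.incl, DirectSum.toModule_lof]

@[simp] theorem Data.totalAct_single (g : G) (r : k) (a : ⨁ g, V g) :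
    A.totalAct (MonoidAlgebra.single g r) a = r • A.actBy g a := by
  simp [Data.totalAct]

end Total

/-! ### The maps `i` and `res` between the twist and the extension. -/

section Lift

variable {k : Type u} [Field k] {G : Type v} [Group G] {V : G → Type w}
  [∀ g, AddCommGroup (V g)] [∀ g, Module k (V g)] {H : Type x} [CommGroup H]

/-- The components of `A^β` in degree `γ` and of `A_α` in degree `π(γ)` are the same space, so
structure maps can be compared directly. This lemma and its analogues for form and action reduce the
lift to an equality of scalars. -/
theorem Data.twist_mul_eq_smul (A : Data k G V) (α : Z2 G kˣ) (β : Z2 G H) (γ δ ω : Ext β)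
    (e : γ * δ = ω) (a : V γ.quo ⊗[k] k) (b : V δ.quo ⊗[k] k) :
    (A.twist α).mul γ.quo δ.quo ω.quo (congrArg Ext.quo e) a b =
      ((α.1 γ.quo δ.quo : kˣ) : k) • (A.extend β).mul γ δ ω e a b := by
  induction a with
  | zero => simp
  | add x y hx hy => simp only [map_add, LinearMap.add_apply, hx, hy, smul_add]
  | tmul a r =>
  induction b with
  | zero => simp
  | add x y hx hy => simp only [map_add, hx, hy, smul_add]
  | tmul b s =>
  rw [Data.extend_mul_tmul, Data.twist_mul_tmul, ← TensorProduct.tmul_smul, smul_eq_mul]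

theorem Data.twist_form_eq_mul (A : Data k G V) (α : Z2 G kˣ) (β : Z2 G H) (γ δ : Ext β)
    (e : γ * δ = 1) (a : V γ.quo ⊗[k] k) (b : V δ.quo ⊗[k] k) :
    (A.twist α).form γ.quo δ.quo (congrArg Ext.quo e) a b =
      ((α.1 γ.quo δ.quo : kˣ) : k) * (A.extend β).form γ δ e a b := by
  induction a with
  | zero => simp
  | add x y hx hy => simp only [map_add, LinearMap.add_apply, hx, hy, mul_add]
  | tmul a r =>
  induction b with
  | zero => simp
  | add x y hx hy => simp only [map_add, hx, hy, mul_add]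
  | tmul b s =>
  rw [Data.extend_form_tmul, Data.twist_form_tmul]
  ring

theorem Data.twist_act_eq_smul (A : Data k G V) (α : Z2 G kˣ) (β : Z2 G H) (γ δ ω : Ext β)
    (e : γ * δ * γ⁻¹ = ω) (a : V δ.quo ⊗[k] k) :
    (A.twist α).act γ.quo δ.quo ω.quo (congrArg Ext.quo e) a =
      ((eps α γ.quo δ.quo : kˣ) : k) • (A.extend β).act γ δ ω e a := by
  induction a with
  | zero => simp
  | add x y hx hy => simp only [map_add, hx, hy, smul_add]
  | tmul a r =>
  rw [Data.extend_act_tmul, Data.twist_act_tmul, ← TensorProduct.tmul_smul, smul_eq_mul]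

variable (A : Data k G V) (α : Z2 G kˣ) (β : Z2 G H) (χ : H →* kˣ) (ν : G → kˣ)

open scoped Classical in
/-- The map `A_α → A^β` given by `a ↦ ν(g) a` from degree `g` to degree `s(g)`. -/
def Data.liftIncl : (⨁ g, V g ⊗[k] k) →ₗ[k] ⨁ γ : Ext β, V γ.quo ⊗[k] k :=
  DirectSum.toModule k G _ fun g => ((ν g : kˣ) : k) • (A.extend β).incl (sec β g)

open scoped Classical in
/-- The map `A^β → A_α` given by `a ↦ χ(h) ν(g)⁻¹ a` from degree `(h, g)` to degree `g`. -/
def Data.liftRes : (⨁ γ : Ext β, V γ.quo ⊗[k] k) →ₗ[k] ⨁ g, V g ⊗[k] k :=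
  DirectSum.toModule k (Ext β) _ fun γ =>
    ((χ γ.ker * (ν γ.quo)⁻¹ : kˣ) : k) • (A.twist α).incl γ.quo

theorem Data.liftIncl_incl (g : G) (a : V g ⊗[k] k) :
    A.liftIncl β ν ((A.twist α).incl g a) =
      ((ν g : kˣ) : k) • (A.extend β).incl (sec β g) a := by
  classical
  exact DirectSum.toModule_lof (M := fun g => V g ⊗[k] k)
    (φ := fun g => ((ν g : kˣ) : k) • (A.extend β).incl (sec β g)) k g a

theorem Data.liftRes_incl (γ : Ext β) (a : V γ.quo ⊗[k] k) :
    A.liftRes α β χ ν ((A.extend β).incl γ a) =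
      ((χ γ.ker * (ν γ.quo)⁻¹ : kˣ) : k) • (A.twist α).incl γ.quo a := by
  simp [Data.liftRes, Data.incl, DirectSum.toModule_lof]

theorem Data.liftRes_incl_sec (g : G) (a : V g ⊗[k] k) :
    A.liftRes α β χ ν ((A.extend β).incl (sec β g) a) =
      (((ν g)⁻¹ : kˣ) : k) • (A.twist α).incl g a := by
  have h : χ (sec β g).ker * (ν (sec β g).quo)⁻¹ = (ν g)⁻¹ := by simp [sec]
  refine (A.liftRes_incl α β χ ν (sec β g) a).trans ?_
  rw [h]
  rfl

/-- Because of this, the diagrams for multiplication and action follow from multiplicativity and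
equivariance of `res`. -/
theorem Data.liftRes_liftIncl (a : ⨁ g, V g ⊗[k] k) :
    A.liftRes α β χ ν (A.liftIncl β ν a) = a := by
  induction a using (A.twist α).total_induction with
  | zero => simp
  | add x y hx hy => simp only [map_add, hx, hy]
  | incl g a =>
  rw [Data.liftIncl_incl, map_smul, Data.liftRes_incl_sec, smul_smul, Units.mul_inv, one_smul]

variable {α β χ ν}

/-- The `H`-component of a product contains `β(g, g')`, and `hν` turns `χ(β(g, g')) ν(gg')⁻¹` into
`α(g, g') ν(g)⁻¹ ν(g')⁻¹`. -/
theorem Data.liftRes_totalMul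
    (hν : ∀ g h, α.1 g h = χ (β.1 g h) * (ν g * ν h * (ν (g * h))⁻¹))
    (a b : ⨁ γ : Ext β, V γ.quo ⊗[k] k) :
    A.liftRes α β χ ν ((A.extend β).totalMul a b) =
      (A.twist α).totalMul (A.liftRes α β χ ν a) (A.liftRes α β χ ν b) := by
  induction a using (A.extend β).total_induction with
  | zero => simp
  | add x y hx hy => simp only [map_add, LinearMap.add_apply, hx, hy]
  | incl γ a =>
  induction b using (A.extend β).total_induction with
  | zero => simp
  | add x y hx hy => simp only [map_add, hx, hy]
  | incl δ b =>
  rw [Data.totalMul_incl _ γ δ _ rfl, Data.liftRes_incl, Data.liftRes_incl, Data.liftRes_incl,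
    map_smul, map_smul, LinearMap.smul_apply, Data.totalMul_incl _ γ.quo δ.quo (γ * δ).quo rfl,
    Data.twist_mul_eq_smul A α β γ δ (γ * δ) rfl, map_smul, smul_smul, smul_smul,
    ← Units.val_mul, ← Units.val_mul]
  congr 2
  simp only [hν, mul_ker, mul_quo, map_mul]
  -- Multiplying both sides by the values of `ν` clears the inverses; the identity is then checked
  -- in `k`.
  rw [← mul_left_inj (ν γ.quo * ν δ.quo * ν (γ.quo * δ.quo)),
    ← mul_right_inj (ν γ.quo * ν δ.quo * ν (γ.quo * δ.quo))]
  ext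
  push_cast
  field_simp

theorem Data.liftRes_actBy
    (hν : ∀ g h, α.1 g h = χ (β.1 g h) * (ν g * ν h * (ν (g * h))⁻¹))
    (γ : Ext β) (a : ⨁ γ : Ext β, V γ.quo ⊗[k] k) :
    A.liftRes α β χ ν ((A.extend β).actBy γ a) =
      (A.twist α).actBy γ.quo (A.liftRes α β χ ν a) := by
  induction a using (A.extend β).total_induction with
  | zero => simp
  | add x y hx hy => simp only [map_add, hx, hy]
  | incl δ a =>
  -- In the quotient defining `ε`, the factors `ν(g)` and `ν(gh)` cancel, since `ghg⁻¹ · g = gh`.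
  have h1 : eps α γ.quo δ.quo = χ (eps β γ.quo δ.quo) *
      (ν δ.quo * (ν (γ.quo * δ.quo * γ.quo⁻¹))⁻¹) := by
    simp only [eps, hν, inv_mul_cancel_right, map_mul, map_inv, mul_inv, inv_inv]
    ext
    push_cast
    field_simp
  rw [Data.actBy_incl _ γ δ _ rfl, Data.liftRes_incl, Data.liftRes_incl,
    map_smul, Data.actBy_incl _ γ.quo δ.quo (γ * δ * γ⁻¹).quo rfl,
    Data.twist_act_eq_smul A α β γ δ (γ * δ * γ⁻¹) rfl, map_smul, smul_smul,
    ← Units.val_mul]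
  congr 2
  rw [h1, ← eps_mul_ker, map_mul, mul_quo, mul_quo, inv_quo]
  ext
  push_cast
  field_simp

/-- If `α` and `χ ∘ β` differ by the coboundary of `ν`, then `A_α` lifts along `χ` to `A^β`. -/
def Data.liftMaps (hν : ∀ g h, α.1 g h = χ (β.1 g h) * (ν g * ν h * (ν (g * h))⁻¹)) :
    LiftMaps χ (A.twist α) (A.extend β) :=
  -- Normalization of both cocycles forces this; the units and the form depend on it.
  have hν1 : ν 1 = 1 := by simpa using (hν 1 1).symm
  { i := A.liftIncl β ν
    res := A.liftRes α β χ ν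
    coact_diagram := LinearMap.ext fun a => by
      induction a using (A.twist α).total_induction with
      | zero => simp
      | add x y hx hy => simp only [map_add, hx, hy]
      | incl g a =>
      simp only [LinearMap.comp_apply]
      have h1 : chiMap β χ (MonoidAlgebra.single (sec β g) 1) =
          MonoidAlgebra.single g (1 : k) := by simp [chiMap, sec]
      have h2 : (A.extend β).coact ((A.extend β).incl (sec β g) a) =
          (A.extend β).incl (sec β g) a ⊗ₜ MonoidAlgebra.single (sec β g) 1 :=
        (A.extend β).coact_incl (sec β g) a
      rw [Data.liftIncl_incl, map_smul, h2, Data.coact_incl, map_smul,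
        TensorProduct.map_tmul, Data.liftRes_incl_sec, ← TensorProduct.smul_tmul', smul_smul,
        Units.mul_inv, one_smul, h1]
    mul_diagram := fun a b => by
      rw [A.liftRes_totalMul hν, Data.liftRes_liftIncl, Data.liftRes_liftIncl]
    act_diagram := fun r a => by
      induction r using MonoidAlgebra.induction_linear with
      | zero => simp
      | add x y hx hy => simp only [map_add, LinearMap.add_apply, hx, hy]
      | single g r =>
      have h1 : secMap k β (MonoidAlgebra.single g r) =
          r • MonoidAlgebra.single (sec β g) 1 := by simp [secMap]
      rw [h1, map_smul, LinearMap.smul_apply, map_smul, Data.totalAct_single, one_smul,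
        A.liftRes_actBy hν, Data.liftRes_liftIncl, Data.totalAct_single]
      rfl
    i_degree := fun g a => ⟨((ν g : kˣ) : k) • a, by
      rw [Data.liftIncl_incl]; exact (map_smul ((A.extend β).incl (sec β g)) _ _).symm⟩
    res_degree := fun γ a => ⟨((χ γ.ker * (ν γ.quo)⁻¹ : kˣ) : k) • a, by
      rw [Data.liftRes_incl, map_smul]⟩
    i_one := by
      rw [Data.liftIncl_incl, hν1, Units.val_one, one_smul]; rfl
    res_one := by
      have h1 : χ (1 : Ext β).ker * (ν (1 : Ext β).quo)⁻¹ = 1 := by simp [hν1]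
      rw [Data.liftRes_incl, h1, Units.val_one, one_smul]
      rfl
    res_mul := A.liftRes_totalMul hν
    res_act := A.liftRes_actBy hν
    res_form := fun γ δ e a b => by
      rw [Data.liftRes_incl, Data.liftRes_incl, map_smul, map_smul, LinearMap.smul_apply,
        Data.totalForm_incl _ γ.quo δ.quo (congrArg Ext.quo e), Data.totalForm_incl _ γ δ e,
        Data.twist_form_eq_mul A α β γ δ e, smul_eq_mul, smul_eq_mul, ← mul_assoc, ← mul_assoc,
        ← Units.val_mul, ← Units.val_mul]
      have h1 : γ.ker * δ.ker * β.1 γ.quo δ.quo = 1 := congrArg Ext.ker e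
      have h2 : γ.quo * δ.quo = 1 := congrArg Ext.quo e
      have h3 := congrArg χ h1
      rw [map_mul, map_mul, map_one] at h3
      -- For mutually inverse degrees `hν` reads `α(g, g') = χ(β(g, g')) ν(g) ν(g')`, so the values
      -- of `ν` cancel and `h3` remains.
      have h4 : χ δ.ker * (ν δ.quo)⁻¹ * (χ γ.ker * (ν γ.quo)⁻¹) * α.1 γ.quo δ.quo = 1 := by
        rw [hν, h2, hν1]
        refine Eq.trans ?_ h3
        ext
        push_cast
        field_simp
      rw [h4, Units.val_one, one_mul]
    char_eq := fun γ => rfl }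

end Lift

/-! ### Characters from lifting the twisted regular representation. -/

section Universal

variable {k : Type u} [Field k] {G : Type v} [Group G]

/-- The left multiplication by `ĝ` on the twisted group ring, as an endomorphism of `G → k`. -/
def twistedRegular (α : Z2 G kˣ) (g : G) : Module.End k (G → k) where
  toFun f x := ((α.1 g (g⁻¹ * x) : kˣ) : k) * f (g⁻¹ * x)
  map_add' f f' := by ext x; simp [mul_add]
  map_smul' r f := by ext x; simp [mul_left_comm]

theorem twistedRegular_one (α : Z2 G kˣ) : twistedRegular α 1 = 1 := by
  ext f x; simp [twistedRegular]

theorem twistedRegular_mul (α : Z2 G kˣ) (g h : G) :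
    twistedRegular α g * twistedRegular α h =
      ((α.1 g h : kˣ) : k) • twistedRegular α (g * h) := by
  refine LinearMap.ext fun f => funext fun x => ?_
  -- The basis vector that `ĝ ĥ` sends to a multiple of `x̂` has degree `(gh)⁻¹x`.
  have := α.2.1 g h (h⁻¹ * (g⁻¹ * x))
  rw [mul_inv_cancel_left] at this
  simp only [twistedRegular, Module.End.mul_apply, LinearMap.coe_mk, AddHom.coe_mk,
    LinearMap.smul_apply, Pi.smul_apply, smul_eq_mul, mul_inv_rev, mul_assoc h⁻¹ g⁻¹ x]
  rw [← mul_assoc (_ : k), ← mul_assoc ((α.1 g h : kˣ) : k), ← Units.val_mul, ← Units.val_mul, mul_comm (α.1 g _), ← this]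

/-- The twisted regular representation realizes `α` on the nose. Its dimension `|G|` is nonzero,
which is recorded because scalars cannot be recovered from empty matrices. -/
theorem exists_projRep [Finite G] (α : Z2 G kˣ) :
    ∃ (n : ℕ) (_ : NeZero n) (ρ : G → GL (Fin n) k), ρ 1 = 1 ∧
      ∀ g h, (ρ g * ρ h).val = ((α.1 g h : kˣ) : k) • (ρ (g * h)).val := by
  classical
  have := Fintype.ofFinite G
  let e : Module.End k (G → k) ≃ₐ[k] Matrix (Fin (Fintype.card G)) (Fin (Fintype.card G)) k :=
    LinearMap.toMatrixAlgEquiv'.trans (Matrix.reindexAlgEquiv k k (Fintype.equivFin G))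
  have key : ∀ g h, e (twistedRegular α g) * e (twistedRegular α h) =
      ((α.1 g h : kˣ) : k) • e (twistedRegular α (g * h)) := fun g h => by
    rw [← map_mul, twistedRegular_mul, map_smul]
  have h1 : e (twistedRegular α 1) = 1 := by rw [twistedRegular_one, map_one]
  -- The operators of `g` and `g⁻¹` multiply to the invertible scalar `α(g, g⁻¹)`.
  have hdet : ∀ g, IsUnit (e (twistedRegular α g)).det := fun g => by
    have h2 := congrArg Matrix.det (key g g⁻¹)
    rw [mul_inv_cancel, h1, Matrix.det_mul, Matrix.det_smul, Matrix.det_one, mul_one] at h2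
    refine isUnit_of_mul_isUnit_left (y := (e (twistedRegular α g⁻¹)).det) ?_
    rw [h2]
    exact (Units.isUnit _).pow _
  refine ⟨Fintype.card G, ⟨Fintype.card_ne_zero⟩,
    fun g => Matrix.GeneralLinearGroup.mk'' _ (hdet g), ?_, fun g h => ?_⟩
  · ext1; exact h1
  · exact key g h

/-- Every cocycle of `G` is, up to a coboundary, the push-out of the cocycle of a universal
extension along a character. -/
theorem IsUniversalExtension.exists_character [Finite G] {H : Type x} [CommGroup H] {β : Z2 G H}
    (hβ : IsUniversalExtension k β) (α : Z2 G kˣ) :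
    ∃ (χ : H →* kˣ) (ν : G → kˣ),
      ∀ g h, α.1 g h = χ (β.1 g h) * (ν g * ν h * (ν (g * h))⁻¹) := by
  obtain ⟨n, hn, ρ, hρ1, hρ⟩ := exists_projRep α
  obtain ⟨R, hR⟩ := hβ.2 n ρ ⟨hρ1, fun g h => ⟨_, hρ g h⟩⟩
  choose c hc using hR
  have inj : ∀ (g : G) (a b : kˣ), (a : k) • (ρ g).val = (b : k) • (ρ g).val → a = b := by
    intro g a b h
    have h1 := congrArg (· * (ρ g)⁻¹.val) h
    simp only [smul_mul_assoc, Units.mul_inv] at h1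
    have h2 := congrFun (congrFun h1 0) 0
    simpa [Units.ext_iff] using h2
  -- Since `R` is multiplicative and `ρ` has cocycle `α`, the scalars `c` trivialize the pullback of
  -- `α` to `G^β`. On `H` that pullback is `1`, so there `c` is a character.
  have cmul : ∀ γ δ, c γ * c δ * α.1 γ.quo δ.quo = c (γ * δ) := fun γ δ => by
    refine inj (γ * δ).quo _ _ ?_
    rw [← hc (γ * δ), map_mul, Units.val_mul (R γ), hc, hc, smul_mul_smul_comm,
      ← Units.val_mul (ρ _), hρ, smul_smul, Units.val_mul, Units.val_mul]
    rfl
  let χ : H →* kˣ := MonoidHom.mk' (fun h => c ⟨h, 1⟩) fun a b => by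
    have h1 : (⟨a, 1⟩ * ⟨b, 1⟩ : Ext β) = ⟨a * b, 1⟩ := by ext <;> simp
    rw [← h1, ← cmul]; simp
  refine ⟨χ, fun g => (c (sec β g))⁻¹, fun g h => ?_⟩
  have h1 := cmul (sec β g) (sec β h)
  -- The product `s(g) s(h)` also equals `(β(g, h), 1) s(gh)`; evaluating `c` on both factorizations
  -- gives the relation between `α` and `χ ∘ β`.
  have h2 := cmul (⟨β.1 g h, 1⟩ : Ext β) (sec β (g * h))
  have h3 : (⟨β.1 g h, 1⟩ : Ext β) * sec β (g * h) = sec β g * sec β h := by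
    ext <;> simp [sec]
  rw [h3, ← h1] at h2
  have h4 : α.1 g h * (c (sec β g) * c (sec β h)) = χ (β.1 g h) * c (sec β (g * h)) := by
    rw [mul_comm]; refine h2.symm.trans ?_; simp [sec, χ]
  simp only [eq_mul_inv_of_mul_eq h4, mul_inv, inv_inv]
  ac_rfl

end Universal

end GFrob
end

theorem mainTheorem8 {k : Type*} [Field k] [CharZero k] {G : Type*} [Group G] [Finite G]
    {H : Type*} [CommGroup H] [Finite H] {V : G → Type*} [∀ g, AddCommGroup (V g)]
    [∀ g, Module k (V g)] (A : GFrob.Data k G V) (hA : A.IsGFrobenius) :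
    (∀ (α : GFrob.Z2 G kˣ) (α' : GFrob.Z2 G H) (χ : H →* kˣ),
      (∀ g g', α.1 g g' = χ (α'.1 g g')) →
        (A.twist α).IsGFrobenius ∧ (A.extend α').IsGFrobenius ∧
        Nonempty (GFrob.LiftMaps χ (A.twist α) (A.extend α')) ∧
        (A.extendPush α' χ).IsGFrobenius ∧
        Nonempty ((A.extendPush α' χ).Iso (A.twist α))) ∧
    (∀ β : GFrob.Z2 G H, GFrob.IsUniversalExtension k β →
      (A.extend β).IsGFrobenius ∧
      ∀ α : GFrob.Z2 G kˣ, (A.twist α).IsGFrobenius ∧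
        ∃ χ : H →* kˣ, Nonempty (GFrob.LiftMaps χ (A.twist α) (A.extend β))) := by
  refine ⟨fun α α' χ hχ => ?_, fun β hβ => ⟨hA.extend β, fun α => ⟨hA.twist α, ?_⟩⟩⟩
  · have f := A.extendPushIsoTwist hχ
    -- Here `α` equals `χ ∘ α'` exactly, so the coboundary is trivial.
    exact ⟨hA.twist α, hA.extend α', ⟨A.liftMaps (ν := fun _ => 1) (by simpa using hχ)⟩,
      f.symm.isGFrobenius (hA.twist α), ⟨f⟩⟩
  · obtain ⟨χ, ν, hν⟩ := hβ.exists_character α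
    exact ⟨χ, ⟨A.liftMaps hν⟩⟩
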